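/- Let $k$ be an arbitrary field and let $R=k[\![x,y]\!]/(x^2)$. Let $\mathsf{D_{sg}}(R)$ be the singularity category of $R$, that is, the Verdier quotient of the bounded derived category of finitely generated $R$-modules by the full subcategory of complexes quasi-isomorphic to perfect complexes (bounded complexes of finitely generated projective $R$-modules); a finitely generated module is regarded as an object of $\mathsf{D_{sg}}(R)$ as a complex concentrated in degree $0$. For a full subcategory $\mathcal{X}$ of a triangulated category $\mathcal{T}$, let $\langle\mathcal{X}\rangle$ be the smallest full subcategory of $\mathcal{T}$ containing $\mathcal{X}$ that is closed under isomorphisms, shifts, finite direct sums and direct summands. For full subcategories $\mathcal{X},\mathcal{Y}$, let $\mathcal{X}*\mathcal{Y}$ be the full subcategory of the objects $M$ for which there is an exact triangle $X\to M\to Y\to X[1]$ with $X\in\mathcal{X}$ and $Y\in\mathcal{Y}$, and put $\mathcal{X}\diamond\mathcal{Y}=\langle\langle\mathcal{X}\rangle*\langle\mathcal{Y}\rangle\rangle$. Put $\langle\mathcal{X}\rangle_0=0$, $\langle\mathcal{X}\rangle_1=\langle\mathcal{X}\rangle$, $\langle\mathcal{X}\rangle_n=\mathcal{X}\diamond\langle\mathcal{X}\rangle_{n-1}$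 for $n\ge2$, and $\langle M\rangle_n=\langle\{M\}\rangle_n$ for an object $M$. The level of an object $N$ with respect to $M$ is $\operatorname{level}_{\mathcal{T}}^M(N)=\inf\{n\ge0\mid N\in\langle M\rangle_{n+1}\}\in\mathbb{N}\cup\{\infty\}$. Then for all positive integers $a,b$ with $a>2b$, the ideals $(x,y^a)$ and $(x,y^b)$ of $R$ are nonzero objects of $\mathsf{D_{sg}}(R)$, $$ (x,y^a)\notin\langle(x,y^b)\rangle_2^{\mathsf{D_{sg}}(R)}, \qquad\text{and}\qquad \operatorname{level}_{\mathsf{D_{sg}}(R)}^{(x,y^b)}\bigl((x,y^a)\bigr)\ge2 . $$ In other words, for the nonzero object $N=(x,y^a)$ it is not true that $\operatorname{level}_{\mathsf{D_{sg}}(R)}^{M}(N)\le1$ for all nonzero objects $M$ of $\mathsf{D_{sg}}(R)$. -/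

import Mathlib

open CategoryTheory Limits Pretriangulated Triangulated

universe u v w

/-! ## Generation in triangulated categories -/

section Generation

variable {T : Type w} [Category.{v} T] [HasZeroObject T] [HasShift T ℤ] [Preadditive T]
  [∀ n : ℤ, (shiftFunctor T n).Additive] [Pretriangulated T]

/-- `⟨P⟩`: the smallest full subcategory containing `P` which is closed under isomorphisms,
shifts, finite direct sums (the empty one, i.e. zero objects, and binary ones) and direct
summands. -/
inductive AddGen (P : ObjectProperty T) : ObjectProperty T
  | of (X : T) (h : P X) : AddGen P X
  | iso (X Y : T) (e : X ≅ Y) (h : AddGen P X) : AddGen P Y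
  | shift (X : T) (n : ℤ) (h : AddGen P X) : AddGen P (X⟦n⟧)
  | zero (X : T) (h : IsZero X) : AddGen P X
  | sum (X Y : T) (hX : AddGen P X) (hY : AddGen P Y) : AddGen P (X ⊞ Y)
  | summand (X Y : T) (h : AddGen P (X ⊞ Y)) : AddGen P X

/-- `P ◇ Q = ⟨⟨P⟩ * ⟨Q⟩⟩`, where `A * B` (Mathlib's `extensionProduct`) consists of the `M`
in an exact triangle `X ⟶ M ⟶ Y ⟶ X⟦1⟧` with `X` in `A` and `Y` in `B`. -/
def diamond (P Q : ObjectProperty T) : ObjectProperty T :=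
  AddGen (ObjectProperty.extensionProduct (AddGen P) (AddGen Q))

/-- `⟨P⟩_n`: `⟨P⟩_0 = 0`, `⟨P⟩_1 = ⟨P⟩` and `⟨P⟩_n = P ◇ ⟨P⟩_{n-1}` for `n ≥ 2`. -/
def genIter (P : ObjectProperty T) : ℕ → ObjectProperty T
  | 0 => fun X => IsZero X
  | 1 => AddGen P
  | n + 2 => diamond P (genIter P (n + 1))

/-- The level of `N` with respect to `M`: the infimum (in `ℕ∞`, so `⊤` if there is none) of the
`n ≥ 0` such that `N` belongs to `⟨M⟩_{n+1}`. -/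
noncomputable def level (M N : T) : ℕ∞ :=
  sInf {l : ℕ∞ | ∃ n : ℕ, l = n ∧ genIter (ObjectProperty.singleton M) (n + 1) N}

end Generation

/-! ## The singularity category of a Noetherian commutative ring -/

section SingularityCategory

set_option linter.unusedSectionVars false

variable (R : Type u) [CommRing R] [IsNoetherianRing R]

/-- The derived category of the abelian category of finitely generated `R`-modules is taken to be
Mathlib's standard localization of cochain complexes at quasi-isomorphisms. -/
noncomputable instance : HasDerivedCategory.{u + 1} (FGModuleCat.{u} R) :=
  HasDerivedCategory.standard _

/-- The bounded derived category of finitely generated `R`-modules. -/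
abbrev BoundedDerivedCategory : Type (u + 1) :=
  (DerivedCategory.TStructure.t (C := FGModuleCat.{u} R)).bounded.FullSubcategory

variable {R}

/-- A perfect complex: a bounded complex of finitely generated projective `R`-modules. -/
structure IsPerfectComplex (K : CochainComplex (FGModuleCat.{u} R) ℤ) : Prop where
  bounded_below : ∃ a : ℤ, ∀ i < a, IsZero (K.X i)
  bounded_above : ∃ b : ℤ, ∀ i > b, IsZero (K.X i)
  projective : ∀ i : ℤ, Module.Projective R (K.X i)

variable (R)

/-- The objects of the derived category which are isomorphic (that is, quasi-isomorphic as
complexes) to a perfect complex. -/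
def derivedPerf : ObjectProperty (DerivedCategory (FGModuleCat.{u} R)) :=
  fun X => ∃ K : CochainComplex (FGModuleCat.{u} R) ℤ,
    IsPerfectComplex K ∧ Nonempty (X ≅ DerivedCategory.Q.obj K)

/-- `perf(R)`, as a full subcategory of the bounded derived category. -/
abbrev perf : ObjectProperty (BoundedDerivedCategory R) :=
  (derivedPerf R).inverseImage
    (DerivedCategory.TStructure.t (C := FGModuleCat.{u} R)).bounded.ι

/-! ### `perf(R)` is a triangulated subcategory, so that the Verdier quotient is triangulated -/

variable {R}

lemma projective_of_moduleProjective (M : FGModuleCat.{u} R) [Module.Projective R M] :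
    Projective M where
  factors {E X} f e _ := by
    have he : Function.Surjective e.hom.hom := by
      have : Epi ((forget₂ (FGModuleCat R) (ModuleCat.{u} R)).map e) := inferInstance
      exact (ModuleCat.epi_iff_surjective _).1 this
    obtain ⟨g, hg⟩ := Module.projective_lifting_property e.hom.hom f.hom.hom he
    refine ⟨ObjectProperty.homMk (ModuleCat.ofHom g), ?_⟩
    ext x
    exact congrArg (fun φ => φ x) hg

lemma moduleProjective_of_retract {M N : FGModuleCat.{u} R} (i : M ⟶ N) (r : N ⟶ M)
    (h : i ≫ r = 𝟙 M) [Module.Projective R N] : Module.Projective R M :=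
  Module.Projective.of_split i.hom.hom r.hom.hom
    (by
      have := congrArg (fun φ : M ⟶ M => φ.hom.hom) h
      exact this)

lemma moduleProjective_biprod (M N : FGModuleCat.{u} R) [Module.Projective R M]
    [Module.Projective R N] : Module.Projective R (M ⊞ N : FGModuleCat.{u} R) := by
  let P : FGModuleCat.{u} R := FGModuleCat.of R (M × N)
  have : Module.Projective R P := inferInstanceAs (Module.Projective R (M × N))
  let i₁ : M ⟶ P := ObjectProperty.homMk (ModuleCat.ofHom (LinearMap.inl R M N))
  let i₂ : N ⟶ P := ObjectProperty.homMk (ModuleCat.ofHom (LinearMap.inr R M N))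
  let p₁ : P ⟶ M := ObjectProperty.homMk (ModuleCat.ofHom (LinearMap.fst R M N))
  let p₂ : P ⟶ N := ObjectProperty.homMk (ModuleCat.ofHom (LinearMap.snd R M N))
  have h₁₁ : i₁ ≫ p₁ = 𝟙 M := rfl
  have h₂₂ : i₂ ≫ p₂ = 𝟙 N := rfl
  have h₁₂ : i₁ ≫ p₂ = 0 := rfl
  have h₂₁ : i₂ ≫ p₁ = 0 := rfl
  refine moduleProjective_of_retract (biprod.desc i₁ i₂) (biprod.lift p₁ p₂) ?_
  apply biprod.hom_ext' <;> apply biprod.hom_ext <;> simp [h₁₁, h₂₂, h₁₂, h₂₁]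

lemma IsPerfectComplex.isStrictlyLE {K : CochainComplex (FGModuleCat.{u} R) ℤ}
    (hK : IsPerfectComplex K) : ∃ b : ℤ, K.IsStrictlyLE b := by
  obtain ⟨b, hb⟩ := hK.bounded_above
  exact ⟨b, (K.isStrictlyLE_iff b).2 hb⟩

lemma IsPerfectComplex.isKProjective {K : CochainComplex (FGModuleCat.{u} R) ℤ}
    (hK : IsPerfectComplex K) : K.IsKProjective := by
  obtain ⟨b, _⟩ := hK.isStrictlyLE
  have (n : ℤ) : Projective (K.X n) :=
    have := hK.projective n
    projective_of_moduleProjective _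
  exact K.isKProjective_of_projective b

lemma isPerfectComplex_of_isZero {K : CochainComplex (FGModuleCat.{u} R) ℤ}
    (hK : ∀ i, IsZero (K.X i)) : IsPerfectComplex K where
  bounded_below := ⟨0, fun i _ => hK i⟩
  bounded_above := ⟨0, fun i _ => hK i⟩
  projective i :=
    have : Module.Projective R (FGModuleCat.of R PUnit.{u + 1}) :=
      inferInstanceAs (Module.Projective R PUnit.{u + 1})
    moduleProjective_of_retract (N := FGModuleCat.of R PUnit.{u + 1}) 0 0 ((hK i).eq_of_src _ _)

lemma IsPerfectComplex.shift {K : CochainComplex (FGModuleCat.{u} R) ℤ}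
    (hK : IsPerfectComplex K) (n : ℤ) : IsPerfectComplex (K⟦n⟧) where
  bounded_below := by
    obtain ⟨a, ha⟩ := hK.bounded_below
    exact ⟨a - n, fun i hi => ha (i + n) (by lia)⟩
  bounded_above := by
    obtain ⟨b, hb⟩ := hK.bounded_above
    exact ⟨b - n, fun i hi => hb (i + n) (by lia)⟩
  projective i := hK.projective (i + n)

lemma IsPerfectComplex.mappingCone {K L : CochainComplex (FGModuleCat.{u} R) ℤ} (φ : K ⟶ L)
    (hK : IsPerfectComplex K) (hL : IsPerfectComplex L) :
    IsPerfectComplex (CochainComplex.mappingCone φ) where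
  bounded_below := by
    obtain ⟨a, ha⟩ := hK.bounded_below
    obtain ⟨a', ha'⟩ := hL.bounded_below
    refine ⟨min (a - 1) a', fun i hi => ?_⟩
    rw [CochainComplex.mappingCone.isZero_X_iff]
    exact ⟨ha _ (by lia), ha' _ (by lia)⟩
  bounded_above := by
    obtain ⟨b, hb⟩ := hK.bounded_above
    obtain ⟨b', hb'⟩ := hL.bounded_above
    refine ⟨max b b', fun i hi => ?_⟩
    rw [CochainComplex.mappingCone.isZero_X_iff]
    exact ⟨hb _ (by lia), hb' _ (by lia)⟩
  projective i := by
    have := HomologicalComplex.HasHomotopyCofiber.hasBinaryBiproduct φ i (i + 1) rfl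
    have := hK.projective (i + 1)
    have := hL.projective i
    have := moduleProjective_biprod (K.X (i + 1)) (L.X i)
    let e := HomologicalComplex.homotopyCofiber.XIsoBiprod φ i (i + 1) rfl
    exact moduleProjective_of_retract e.hom e.inv e.hom_inv_id

instance : (derivedPerf R).IsClosedUnderIsomorphisms where
  of_iso e := by
    rintro ⟨K, hK, ⟨e'⟩⟩
    exact ⟨K, hK, ⟨e.symm ≪≫ e'⟩⟩

instance : (derivedPerf R).IsStableUnderShift ℤ where
  isStableUnderShiftBy n :=
    { le_shift := by
        rintro X ⟨K, hK, ⟨e⟩⟩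
        exact ⟨K⟦n⟧, hK.shift n, ⟨(shiftFunctor _ n).mapIso e ≪≫
          (DerivedCategory.Q.commShiftIso n).symm.app K⟩⟩ }

lemma exists_Q_map_eq {K L : CochainComplex (FGModuleCat.{u} R) ℤ} (hK : IsPerfectComplex K)
    (f : DerivedCategory.Q.obj K ⟶ DerivedCategory.Q.obj L) :
    ∃ φ : K ⟶ L, DerivedCategory.Q.map φ = f := by
  have := hK.isKProjective
  let e := DerivedCategory.quotientCompQhIso (FGModuleCat.{u} R)
  obtain ⟨g, hg⟩ := (CochainComplex.IsKProjective.Qh_map_bijective K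
    ((HomotopyCategory.quotient _ _).obj L)).surjective (e.hom.app K ≫ f ≫ e.inv.app L)
  obtain ⟨φ, rfl⟩ := (HomotopyCategory.quotient _ _).map_surjective g
  refine ⟨φ, ?_⟩
  rw [← cancel_epi (e.hom.app K), ← DerivedCategory.quotientCompQhIso_hom_naturality, hg]
  simp [e]

instance : (derivedPerf R).IsTriangulatedClosed₃ := .mk' (by
  rintro T hT ⟨K, hK, ⟨e₁⟩⟩ ⟨L, hL, ⟨e₂⟩⟩
  obtain ⟨φ, hφ⟩ := exists_Q_map_eq hK (e₁.inv ≫ T.mor₁ ≫ e₂.hom)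
  refine ⟨_, hK.mappingCone φ hL, ⟨?_⟩⟩
  exact Triangle.π₃.mapIso (isoTriangleOfIso₁₂ T _ hT
    (DerivedCategory.mappingCone_triangle_distinguished φ) e₁ e₂ (by
      change T.mor₁ ≫ e₂.hom = e₁.hom ≫ DerivedCategory.Q.map φ
      rw [hφ, Iso.hom_inv_id_assoc])))

instance : (derivedPerf R).IsTriangulated where
  exists_zero := by
    obtain ⟨Z, hZ⟩ := HasZeroObject.zero (C := CochainComplex (FGModuleCat.{u} R) ℤ)
    exact ⟨DerivedCategory.Q.obj Z, DerivedCategory.Q.map_isZero hZ, Z,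
      isPerfectComplex_of_isZero fun i => (HomologicalComplex.eval _ _ i).map_isZero hZ,
      ⟨Iso.refl _⟩⟩
  toIsTriangulatedClosed₂ := .of_isTriangulatedClosed₃

variable (R)

/-- The singularity category `D_sg(R)`: the Verdier quotient of the bounded derived category by
`perf(R)`, i.e. its localization at the morphisms whose cone belongs to `perf(R)`. It carries
Mathlib's triangulated structure on such a localization. -/
abbrev SingularityCategory : Type (u + 1) :=
  (perf R).trW.Localization


variable {R}

/-- A finitely generated module, as a complex concentrated in degree `0`, in the bounded derived
category. -/
noncomputable def boundedSingle (M : FGModuleCat.{u} R) : BoundedDerivedCategory R :=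
  ⟨(DerivedCategory.singleFunctor (FGModuleCat.{u} R) 0).obj M,
    ⟨⟨0, inferInstance⟩, ⟨0, inferInstance⟩⟩⟩

/-- A finitely generated module, as an object of the singularity category. -/
noncomputable def toSingularityCategory (M : FGModuleCat.{u} R) : SingularityCategory R :=
  (perf R).trW.Q.obj (boundedSingle M)

end SingularityCategory

/-! ## The hypersurface `k[[x,y]]/(x²)` -/

section Hypersurface

variable (k : Type u) [Field k]

/-- The ring `k[[x,y]]/(x²)`, with `x` and `y` the variables of index `0` and `1`. -/
abbrev HypersurfaceA : Type u :=
  MvPowerSeries (Fin 2) k ⧸ Ideal.span {(MvPowerSeries.X 0 ^ 2 : MvPowerSeries (Fin 2) k)}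

/-- The class of `x` in `k[[x,y]]/(x²)`. -/
noncomputable def varX : HypersurfaceA k := Ideal.Quotient.mk _ (MvPowerSeries.X 0)

/-- The class of `y` in `k[[x,y]]/(x²)`. -/
noncomputable def varY : HypersurfaceA k := Ideal.Quotient.mk _ (MvPowerSeries.X 1)

/-- The ideal `(x, y^n)` of `k[[x,y]]/(x²)`. -/
noncomputable def idealXY (n : ℕ) : Ideal (HypersurfaceA k) := Ideal.span {varX k, varY k ^ n}

/-- The ideal `(x, y^n)` of `R = k[[x,y]]/(x²)`, viewed as an `R`-module and hence as an object of
the singularity category of `R`. -/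
noncomputable def idealXYObj (n : ℕ) : SingularityCategory (HypersurfaceA k) :=
  toSingularityCategory (FGModuleCat.of (HypersurfaceA k) (idealXY k n))

end Hypersurface

/-! ## Objects annihilated by a scalar -/

section Annihilation

set_option linter.unusedSectionVars false

variable {T : Type w} [Category.{v} T] [HasZeroObject T] [HasShift T ℤ] [Preadditive T]
  [∀ n : ℤ, (shiftFunctor T n).Additive] [Pretriangulated T]
  {R : Type u} [CommRing R] [Linear R T]

/-! The category `D_sg(R)` is `R`-linear, so one can ask which powers of `y` act as zero on an
object. Shifts, sums and summands preserve annihilation by a scalar, while an extension multiplies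
annihilators; hence if `y ^ b` kills `M`, then `y ^ (b * m)` kills `⟨M⟩_m`. It remains to see that
`y ^ c` kills `(x, y ^ n)` exactly when `n ≤ c`: membership of `(x, y ^ a)` in `⟨(x, y ^ b)⟩_2`
would then force `a ≤ 2 * b`.

If `n ≤ c`, multiplication by `y ^ c` on the ideal factors through `R`, which is zero in `D_sg(R)`.
For the converse, the ideal `I = (x, y ^ n)` is its own syzygy: `0 → I → R² → I → 0`. A scalar that
is zero on `I` in `D_sg(R)` is zero on extensions of high degree; periodicity brings this down to
the class of the sequence itself, so the scalar lifts through `R² → I`. An explicit computation with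
such a lift finishes (`exists_lift_of_annihilatedBy`, `le_of_annihilatedBy_span_pair`). -/

variable (T) in
/-- The objects `X` such that `r` acts as zero on `X`. -/
def annihilatedBy (r : R) : ObjectProperty T := fun X => r • 𝟙 X = 0

lemma annihilatedBy_of_retract {X Y : T} {r : R} (i : X ⟶ Y) (p : Y ⟶ X) (h : i ≫ p = 𝟙 X)
    (hY : annihilatedBy T r Y) : annihilatedBy T r X := by
  have : r • 𝟙 X = i ≫ (r • 𝟙 Y) ≫ p := by simp [h]
  rw [annihilatedBy, this, hY]
  simp

lemma AddGen_le_annihilatedBy [∀ n : ℤ, (shiftFunctor T n).Linear R] {P : ObjectProperty T}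
    {r : R} (hP : P ≤ annihilatedBy T r) : AddGen P ≤ annihilatedBy T r := by
  intro X hX
  induction hX with
  | of X h => exact hP _ h
  | iso X Y e _ ih => exact annihilatedBy_of_retract e.inv e.hom e.inv_hom_id ih
  | shift X n _ ih =>
    rw [annihilatedBy] at ih ⊢
    rw [← CategoryTheory.Functor.map_id, ← Functor.map_smul, ih, Functor.map_zero]
  | zero X h => exact h.eq_of_src _ _
  | sum X Y _ _ hX hY =>
    rw [annihilatedBy] at hX hY ⊢
    rw [← biprod.total, smul_add, ← Category.id_comp biprod.fst, ← Category.id_comp biprod.snd]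
    have h₁ : r • (biprod.fst ≫ biprod.inl : X ⊞ Y ⟶ X ⊞ Y) =
        biprod.fst ≫ (r • 𝟙 X) ≫ biprod.inl := by simp
    have h₂ : r • (biprod.snd ≫ biprod.inr : X ⊞ Y ⟶ X ⊞ Y) =
        biprod.snd ≫ (r • 𝟙 Y) ≫ biprod.inr := by simp
    simp only [Category.id_comp, h₁, h₂, hX, hY]
    simp
  | summand X Y _ ih => exact annihilatedBy_of_retract biprod.inl biprod.fst (by simp) ih

/-- Since `s` kills `Y`, the action of `s` on `M` factors through `X ⟶ M`, and `r` kills `X`. -/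
lemma extensionProduct_le_annihilatedBy {P Q : ObjectProperty T} {r s : R}
    (hP : P ≤ annihilatedBy T r) (hQ : Q ≤ annihilatedBy T s) :
    P.extensionProduct Q ≤ annihilatedBy T (r * s) := by
  intro M hM
  rw [ObjectProperty.extensionProduct_iff] at hM
  obtain ⟨X, Y, f, g, h, hT, hX, hY⟩ := hM
  have hY' : s • 𝟙 Y = 0 := hQ _ hY
  have hX' : r • 𝟙 X = 0 := hP _ hX
  have hg : (s • 𝟙 M) ≫ g = 0 := by
    have : (s • 𝟙 M) ≫ g = g ≫ (s • 𝟙 Y) := by simp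
    rw [this, hY', comp_zero]
  obtain ⟨φ, hφ⟩ : ∃ φ : M ⟶ X, s • 𝟙 M = φ ≫ f := Triangle.coyoneda_exact₂ _ hT (s • 𝟙 M) hg
  have : φ ≫ (r • 𝟙 X) ≫ f = r • (φ ≫ f) := by simp
  rw [annihilatedBy, mul_smul, hφ, ← this, hX', zero_comp, comp_zero]

lemma genIter_le_annihilatedBy [∀ n : ℤ, (shiftFunctor T n).Linear R] {P : ObjectProperty T}
    {r : R} (hP : P ≤ annihilatedBy T r) (n : ℕ) : genIter P n ≤ annihilatedBy T (r ^ n) := by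
  induction n with
  | zero => exact fun X hX => IsZero.eq_of_src hX _ _
  | succ n ih =>
    cases n with
    | zero => simpa [genIter] using AddGen_le_annihilatedBy hP
    | succ n =>
      rw [pow_succ']
      exact AddGen_le_annihilatedBy (extensionProduct_le_annihilatedBy
        (AddGen_le_annihilatedBy hP) (AddGen_le_annihilatedBy ih))

end Annihilation

/-! ### Linear structure of the singularity category, and its zero objects and morphisms -/

instance {T : Type w} [Category.{v} T] [HasShift T ℤ] [Preadditive T] {R : Type u} [Ring R]
    [Linear R T] [∀ n : ℤ, (shiftFunctor T n).Linear R] (P : ObjectProperty T)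
    [P.IsStableUnderShift ℤ] (n : ℤ) : (shiftFunctor P.FullSubcategory n).Linear R where
  map_smul f r := P.ι.map_injective (by
    have : (shiftFunctor P.FullSubcategory n ⋙ P.ι).Linear R :=
      Functor.linear_of_iso R (P.ι.commShiftIso n).symm
    rw [P.ι.map_smul]
    exact (shiftFunctor P.FullSubcategory n ⋙ P.ι).map_smul r f)

section Singularity

variable (R : Type u) [CommRing R] [IsNoetherianRing R]

instance (n : ℤ) : (shiftFunctor (SingularityCategory R) n).Linear R :=
  Shift.linear_of_localization R (perf R).trW.Q (perf R).trW n

/-- The functor from finitely generated modules to the bounded derived category. -/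
noncomputable def boundedSingleFunctor : FGModuleCat.{u} R ⥤ BoundedDerivedCategory R :=
  ObjectProperty.lift _ (DerivedCategory.singleFunctor (FGModuleCat.{u} R) 0)
    fun M => (boundedSingle M).property

instance : (boundedSingleFunctor R).Linear R where
  map_smul f r := (DerivedCategory.TStructure.t (C := FGModuleCat.{u} R)).bounded.ι.map_injective
    ((DerivedCategory.singleFunctor (FGModuleCat.{u} R) 0).map_smul r f)

/-- The functor from finitely generated modules to the singularity category. -/
noncomputable abbrev singularityFunctor : FGModuleCat.{u} R ⥤ SingularityCategory R :=
  boundedSingleFunctor R ⋙ (perf R).trW.Q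

variable {R}

lemma toSingularityCategory_eq (M : FGModuleCat.{u} R) :
    toSingularityCategory M = (singularityFunctor R).obj M := rfl

lemma moduleProjective_of_isZero {M : FGModuleCat.{u} R} (hM : IsZero M) : Module.Projective R M :=
  have : Module.Projective R (FGModuleCat.of R PUnit.{u + 1}) :=
    inferInstanceAs (Module.Projective R PUnit.{u + 1})
  moduleProjective_of_retract (N := FGModuleCat.of R PUnit.{u + 1}) 0 0 (hM.eq_of_src _ _)

lemma isPerfectComplex_single (F : FGModuleCat.{u} R) [Module.Projective R F] :
    IsPerfectComplex ((CochainComplex.singleFunctor (FGModuleCat.{u} R) 0).obj F) where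
  bounded_below := ⟨0, fun i hi => HomologicalComplex.isZero_single_obj_X _ _ _ _ hi.ne⟩
  bounded_above := ⟨0, fun i hi => HomologicalComplex.isZero_single_obj_X _ _ _ _ hi.ne'⟩
  projective i := by
    by_cases hi : i = 0
    · subst hi
      let e := HomologicalComplex.singleObjXSelf (ComplexShape.up ℤ) (0 : ℤ) F
      exact moduleProjective_of_retract e.hom e.inv e.hom_inv_id
    · exact moduleProjective_of_isZero (HomologicalComplex.isZero_single_obj_X _ _ _ _ hi)

/-- Perfect complexes are K-projective, so the morphism comes from a chain map, whose only possibly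
nonzero component starts at `K.X j`. -/
lemma IsPerfectComplex.hom_single_eq_zero {K : CochainComplex (FGModuleCat.{u} R) ℤ}
    (hK : IsPerfectComplex K) {j : ℤ} (hj : IsZero (K.X j)) {W : FGModuleCat.{u} R}
    (f : DerivedCategory.Q.obj K ⟶ (DerivedCategory.singleFunctor _ j).obj W) : f = 0 := by
  obtain ⟨φ, rfl⟩ := exists_Q_map_eq (L := (HomologicalComplex.single _ _ j).obj W) hK f
  rw [show φ = 0 from HomologicalComplex.to_single_hom_ext (hj.eq_of_src _ _), Functor.map_zero]
  rfl

-- The cone of `0 ⟶ F` is the perfect object `F`, so this morphism becomes invertible in the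
-- quotient.
open ZeroObject in
lemma isZero_singularityFunctor_obj (F : FGModuleCat.{u} R) [Module.Projective R F] :
    IsZero ((singularityFunctor R).obj F) := by
  have hF : perf R (boundedSingle F) := ⟨_, isPerfectComplex_single F, ⟨Iso.refl _⟩⟩
  have hW : (perf R).trW (0 : (0 : BoundedDerivedCategory R) ⟶ boundedSingle F) := by
    rw [ObjectProperty.trW_iff]
    exact ⟨_, _, _, contractible_distinguished₁ (boundedSingle F), hF⟩
  have := Localization.inverts (perf R).trW.Q (perf R).trW _ hW
  exact IsZero.of_iso ((perf R).trW.Q.map_isZero (isZero_zero _))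
    (asIso ((perf R).trW.Q.map (0 : (0 : BoundedDerivedCategory R) ⟶ boundedSingle F))).symm

/-- A scalar whose action on `M` factors through a projective module annihilates `M` in the
singularity category. -/
lemma annihilatedBy_of_factors {M F : FGModuleCat.{u} R} [Module.Projective R F] {r : R}
    (i : M ⟶ F) (p : F ⟶ M) (h : i ≫ p = r • 𝟙 M) :
    annihilatedBy (SingularityCategory R) r (toSingularityCategory M) := by
  have h₁ := congrArg (singularityFunctor R).map h
  rw [Functor.map_comp, Functor.map_smul, CategoryTheory.Functor.map_id,
    (isZero_singularityFunctor_obj F).eq_of_tgt ((singularityFunctor R).map i) 0, zero_comp] at h₁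
  exact h₁.symm

/-- A morphism of modules which vanishes in the singularity category acts as zero on extensions
of high degree. -/
lemma exists_comp_eq_zero_of_singularityFunctor_map_eq_zero {M N : FGModuleCat.{u} R} (f : M ⟶ N)
    (hf : (singularityFunctor R).map f = 0) :
    ∃ a : ℤ, ∀ j < a, ∀ (W : FGModuleCat.{u} R)
      (g : (DerivedCategory.singleFunctor _ 0).obj N ⟶ (DerivedCategory.singleFunctor _ j).obj W),
      (DerivedCategory.singleFunctor _ 0).map f ≫ g = 0 := by
  -- Calculus of fractions: `f` dies after some `s : N ⟶ Z` with perfect cone, hence factors through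
  -- the perfect fibre `P` of `s`. The required bound is the lower bound of a complex representing
  -- `P`.
  obtain ⟨Z, s, hs, hfs⟩ := (MorphismProperty.map_eq_iff_postcomp (perf R).trW.Q (perf R).trW
    ((boundedSingleFunctor R).map f) 0).1 (by rw [Functor.map_zero]; exact hf)
  rw [zero_comp] at hfs
  rw [ObjectProperty.trW_iff'] at hs
  obtain ⟨P, α, β, hT, K, hK, ⟨e⟩⟩ := hs
  obtain ⟨φ, hφ⟩ : ∃ φ : (boundedSingleFunctor R).obj M ⟶ P,
      (boundedSingleFunctor R).map f = φ ≫ α := Triangle.coyoneda_exact₂ _ hT _ hfs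
  obtain ⟨a, ha⟩ := hK.bounded_below
  refine ⟨a, fun j hj W g => ?_⟩
  have hφ' : (DerivedCategory.singleFunctor _ 0).map f = φ.hom ≫ α.hom :=
    congrArg (fun ψ => ψ.hom) hφ
  have h₀ : e.inv ≫ α.hom ≫ g = 0 := hK.hom_single_eq_zero (ha j hj) _
  have h₁ : α.hom ≫ g = 0 := by
    rw [← cancel_epi e.inv, comp_zero]
    exact h₀
  rw [hφ']
  exact (Category.assoc φ.hom α.hom g).trans ((congrArg (φ.hom ≫ ·) h₁).trans comp_zero)

end Singularity

/-! ### Modules that are their own syzygy -/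

section Periodic

variable {R : Type u} [CommRing R] [IsNoetherianRing R]

open DerivedCategory in
/-- Let `0 ⟶ M ⟶ F ⟶ M ⟶ 0` be exact with `F` projective. A scalar annihilating `M` in the
singularity category acts on `M` through the projection `F ⟶ M`. -/
lemma exists_lift_of_annihilatedBy {M F : FGModuleCat.{u} R} [Module.Projective R F]
    (f : M ⟶ F) (g : F ⟶ M) (w : f ≫ g = 0) (hS : (ShortComplex.mk f g w).ShortExact) {r : R}
    (hr : annihilatedBy (SingularityCategory R) r (toSingularityCategory M)) :
    ∃ φ : M ⟶ F, φ ≫ g = r • 𝟙 M := by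
  by_contra! hne
  have hT := hS.singleTriangle_distinguished
  let S := (singleFunctor (FGModuleCat.{u} R) 0).obj M
  -- A class in `Ext^(m+1)(M, M)` not killed by `r`, for every `m`: the extension class first, then
  -- Yoneda products with it.
  have key (m : ℕ) : ∃ h : S ⟶ (singleFunctor (FGModuleCat.{u} R) (-(m + 1 : ℤ))).obj M,
      r • h ≠ 0 := by
    induction m with
    | zero =>
      let e := (singleFunctors (FGModuleCat.{u} R)).shiftIso 1 (-((0 : ℕ) + 1 : ℤ)) 0 (by simp)
      refine ⟨hS.singleδ ≫ e.hom.app M, fun h₀ => ?_⟩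
      rw [← Linear.smul_comp, Preadditive.IsIso.comp_right_eq_zero] at h₀
      have h₁ : (r • 𝟙 S) ≫ hS.singleδ = 0 := by rw [Linear.smul_comp, Category.id_comp, h₀]
      obtain ⟨ψ, hψ⟩ : ∃ ψ : S ⟶ (singleFunctor (FGModuleCat.{u} R) 0).obj F,
        r • 𝟙 S = ψ ≫ (singleFunctor (FGModuleCat.{u} R) 0).map g :=
          Triangle.coyoneda_exact₃ _ hT (r • 𝟙 S) h₁
      obtain ⟨φ, rfl⟩ := (singleFunctor (FGModuleCat.{u} R) 0).map_surjective ψ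
      refine hne φ ((singleFunctor (FGModuleCat.{u} R) 0).map_injective ?_)
      rw [Functor.map_comp, ← hψ, Functor.map_smul, CategoryTheory.Functor.map_id]
    | succ m ih =>
      obtain ⟨h, hh⟩ := ih
      let e := (singleFunctors (FGModuleCat.{u} R)).shiftIso 1 (-((m + 1 : ℕ) + 1 : ℤ))
        (-(m + 1 : ℤ)) (by push_cast; ring)
      refine ⟨hS.singleδ ≫ h⟦1⟧' ≫ e.hom.app M, fun h₀ => hh ?_⟩
      rw [← Category.assoc, ← Linear.smul_comp, Preadditive.IsIso.comp_right_eq_zero,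
        ← Linear.comp_smul, ← Functor.map_smul] at h₀
      obtain ⟨ψ, hψ⟩ : ∃ ψ : ((singleFunctor (FGModuleCat.{u} R) 0).obj F)⟦(1 : ℤ)⟧ ⟶ _,
        (r • h)⟦(1 : ℤ)⟧' = (-((singleFunctor (FGModuleCat.{u} R) 0).map f)⟦(1 : ℤ)⟧') ≫ ψ :=
          Triangle.yoneda_exact₃ _ (rot_of_distTriang _ hT) ((r • h)⟦(1 : ℤ)⟧') h₀
      obtain ⟨ψ, rfl⟩ :=
        (shiftFunctor (DerivedCategory (FGModuleCat.{u} R)) (1 : ℤ)).map_surjective ψ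
      -- Positive extensions of the projective `F` vanish, so the product with the extension class
      -- loses nothing.
      have hψ₀ : ψ = 0 := (isPerfectComplex_single F).hom_single_eq_zero
        (HomologicalComplex.isZero_single_obj_X _ _ _ _ (by lia)) ψ
      apply (shiftFunctor (DerivedCategory (FGModuleCat.{u} R)) (1 : ℤ)).map_injective
      rw [hψ, hψ₀, Functor.map_zero, comp_zero, Functor.map_zero]
  obtain ⟨a, ha⟩ := exists_comp_eq_zero_of_singularityFunctor_map_eq_zero (r • 𝟙 M) (by
    rw [Functor.map_smul, CategoryTheory.Functor.map_id]; exact hr)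
  obtain ⟨h, hh⟩ := key a.natAbs
  refine hh (Eq.trans ?_ (ha _ (by lia) M h))
  rw [Functor.map_smul, CategoryTheory.Functor.map_id, Linear.smul_comp]
  exact congrArg (r • ·) (Category.id_comp h).symm

/-- If `M = F / ker p` and `ker p` is both the kernel and the range of an endomorphism of the
projective module `F`, then a scalar annihilating `M` in the singularity category acts on `M`
through `p`. -/
lemma exists_linearMap_of_annihilatedBy {M F : Type u} [AddCommGroup M] [Module R M]
    [Module.Finite R M] [AddCommGroup F] [Module R F] [Module.Finite R F] [Module.Projective R F]
    (p : F →ₗ[R] M) (hp : Function.Surjective p) (Φ : F →ₗ[R] F)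
    (hker : LinearMap.ker Φ = LinearMap.ker p) (hrange : LinearMap.range Φ = LinearMap.ker p)
    {r : R} (hr : annihilatedBy (SingularityCategory R) r
      (toSingularityCategory (FGModuleCat.of R M))) :
    ∃ φ : M →ₗ[R] F, ∀ m, p (φ m) = r • m := by
  -- The map that `Φ` induces on `M ≅ F / ker p`; it is injective with image `ker p`.
  let ι : M →ₗ[R] F := (LinearMap.ker p).liftQ Φ hker.ge ∘ₗ (p.quotKerEquivOfSurjective hp).symm
  have hι (v : F) : ι (p v) = Φ v := by
    have : (p.quotKerEquivOfSurjective hp).symm (p v) = (LinearMap.ker p).mkQ v := by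
      rw [LinearEquiv.symm_apply_eq]
      rfl
    simp only [ι, LinearMap.comp_apply, LinearEquiv.coe_coe, this]
    rfl
  let f : FGModuleCat.of R M ⟶ FGModuleCat.of R F := ObjectProperty.homMk (ModuleCat.ofHom ι)
  let g : FGModuleCat.of R F ⟶ FGModuleCat.of R M := ObjectProperty.homMk (ModuleCat.ofHom p)
  have hpΦ (v : F) : p (Φ v) = 0 := hrange.le ⟨v, rfl⟩
  have hpι (m : M) : p (ι m) = 0 := by
    obtain ⟨v, rfl⟩ := hp m
    rw [hι, hpΦ]
  have w : f ≫ g = 0 := by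
    ext m
    exact hpι m
  let U := forget₂ (FGModuleCat.{u} R) (ModuleCat.{u} R)
  have hS : (ShortComplex.mk f g w).ShortExact :=
    { exact := by
        rw [← ShortComplex.exact_map_iff_of_faithful _ U, ShortComplex.moduleCat_exact_iff]
        intro v hv
        obtain ⟨v', rfl⟩ := hrange.ge (show v ∈ LinearMap.ker p from hv)
        exact ⟨p v', hι v'⟩
      mono_f := U.mono_of_mono_map ((ModuleCat.mono_iff_injective _).2 (by
        refine (injective_iff_map_eq_zero ι).2 fun m hm => ?_
        obtain ⟨v, rfl⟩ := hp m
        rw [hι] at hm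
        exact hker.le hm))
      epi_g := U.epi_of_epi_map ((ModuleCat.epi_iff_surjective _).2 hp) }
  have : Module.Projective R (FGModuleCat.of R F) := inferInstanceAs (Module.Projective R F)
  obtain ⟨φ, hφ⟩ := exists_lift_of_annihilatedBy f g w hS hr
  exact ⟨φ.hom.hom, fun m => congrArg (fun ψ : FGModuleCat.of R M ⟶ FGModuleCat.of R M =>
    ψ.hom.hom m) hφ⟩

/-- If `x ^ 2 = 0`, the annihilator of `x` is `(x)`, and `y` is a nonzerodivisor modulo `x` with
`(x, y)` proper, then `y ^ c` annihilates the ideal `(x, y ^ n)` in the singularity category only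
if `n ≤ c`. -/
lemma le_of_annihilatedBy_span_pair {x y : R} (hx₀ : x * x = 0) (hx : ∀ t, x * t = 0 → x ∣ t)
    (hy : ∀ t, x ∣ y * t → x ∣ t) (hxy : ∀ s t, x * s + y * t ≠ 1) {n c : ℕ}
    (h : annihilatedBy (SingularityCategory R) (y ^ c)
      (toSingularityCategory (FGModuleCat.of R (Ideal.span {x, y ^ n})))) : n ≤ c := by
  by_contra! hnc
  have hy' (m : ℕ) (t : R) (ht : x ∣ y ^ m * t) : x ∣ t := by
    induction m with
    | zero => simpa using ht
    | succ m ih => exact ih (hy _ (by rwa [← mul_assoc, ← pow_succ']))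
  have mem_x : x ∈ Ideal.span {x, y ^ n} := Ideal.subset_span (by simp)
  have mem_y : y ^ n ∈ Ideal.span {x, y ^ n} := Ideal.subset_span (by simp)
  let p : R × R →ₗ[R] Ideal.span {x, y ^ n} :=
    (LinearMap.toSpanSingleton R _ ⟨x, mem_x⟩).coprod (LinearMap.toSpanSingleton R _ ⟨y ^ n, mem_y⟩)
  have hp_apply (s t : R) : (p (s, t) : R) = s * x + t * y ^ n := rfl
  have hp : Function.Surjective p := by
    rintro ⟨z, hz⟩
    obtain ⟨s, t, rfl⟩ := Ideal.mem_span_pair.1 hz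
    exact ⟨(s, t), rfl⟩
  -- The matrix with rows `(x, y ^ n)` and `(0, -x)`, whose square is `x ^ 2` times the identity: a
  -- matrix factorization of `x ^ 2`.
  let Φ : R × R →ₗ[R] R × R :=
    (LinearMap.toSpanSingleton R _ (x, 0)).coprod (LinearMap.toSpanSingleton R _ (y ^ n, -x))
  have hΦ_apply (s t : R) : Φ (s, t) = (s * x + t * y ^ n, -(t * x)) := by
    simp [Φ]
  have hp_ker (s t : R) (hst : s * x + t * y ^ n = 0) :
      ∃ a b, s = a * x + b * y ^ n ∧ t = -(b * x) := by
    obtain ⟨b, rfl⟩ := hy' n t ⟨-s, by linear_combination hst⟩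
    obtain ⟨a, ha⟩ := hx (s + b * y ^ n) (by linear_combination hst)
    exact ⟨a, -b, by linear_combination ha, by ring⟩
  have hrange : LinearMap.range Φ = LinearMap.ker p := by
    ext ⟨s, t⟩
    simp only [LinearMap.mem_range, LinearMap.mem_ker, Subtype.ext_iff, hp_apply, Prod.exists,
      hΦ_apply, Prod.mk.injEq, ZeroMemClass.coe_zero]
    constructor
    · rintro ⟨a, b, rfl, rfl⟩
      linear_combination a * hx₀
    · intro hst
      obtain ⟨a, b, rfl, rfl⟩ := hp_ker s t hst
      exact ⟨a, b, rfl, rfl⟩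
  have hker : LinearMap.ker Φ = LinearMap.ker p := by
    ext ⟨s, t⟩
    simp only [LinearMap.mem_ker, Subtype.ext_iff, hp_apply, hΦ_apply, Prod.mk_eq_zero,
      ZeroMemClass.coe_zero, and_iff_left_iff_imp]
    intro hst
    obtain ⟨a, b, rfl, rfl⟩ := hp_ker s t hst
    linear_combination b * hx₀
  obtain ⟨φ, hφ⟩ := exists_linearMap_of_annihilatedBy p hp Φ hker hrange h
  -- As `x ^ 2 = 0`, both coordinates of `φ x` are killed by `x`, hence divisible by `x`.
  have hxφ : x • φ ⟨x, mem_x⟩ = 0 := by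
    rw [← map_smul, show x • (⟨x, mem_x⟩ : Ideal.span {x, y ^ n}) = 0 from Subtype.ext hx₀,
      map_zero]
  rcases hst : φ ⟨x, mem_x⟩ with ⟨s, t⟩
  rw [hst, Prod.smul_mk, Prod.mk_eq_zero] at hxφ
  obtain ⟨s', rfl⟩ := hx s hxφ.1
  obtain ⟨t', rfl⟩ := hx t hxφ.2
  have h₁ : x * s' * x + x * t' * y ^ n = y ^ c * x := by
    rw [← hp_apply, ← hst, hφ]
    rfl
  obtain ⟨d, rfl⟩ := Nat.exists_eq_add_of_lt hnc
  -- Here `n = c + d + 1`, and `h₁` says that `x` kills `y ^ c * (1 - y ^ (d + 1) * t')`. Cancelling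
  -- `y ^ c` modulo `x` puts `1` in `(x, y)`.
  obtain ⟨q, hq⟩ := hx (y ^ c * (1 - y ^ (d + 1) * t')) (by
    linear_combination -h₁ + s' * hx₀)
  obtain ⟨q', hq'⟩ := hy' c _ ⟨q, hq⟩
  exact hxy q' (y ^ d * t') (by linear_combination -hq')

/-- The scalar `y` annihilates in the singularity category every ideal containing it. -/
lemma annihilatedBy_ideal_of_mem {I : Ideal R} {y : R} (hy : y ∈ I) :
    annihilatedBy (SingularityCategory R) y (toSingularityCategory (FGModuleCat.of R I)) := by
  have : Module.Projective R (FGModuleCat.of R R) := inferInstanceAs (Module.Projective R R)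
  refine annihilatedBy_of_factors (F := FGModuleCat.of R R)
    (ObjectProperty.homMk (ModuleCat.ofHom I.subtype))
    (ObjectProperty.homMk (ModuleCat.ofHom (LinearMap.toSpanSingleton R I ⟨y, hy⟩))) ?_
  ext z
  exact mul_comm (z : R) y

end Periodic

/-! ### The ideals `(x, y ^ n)` of `k[[x,y]]/(x²)` -/

section Hypersurface

variable (k : Type u) [Field k]

lemma MvPowerSeries.X_dvd_of_X_dvd_X_mul {σ A : Type*} [CommSemiring A] {i j : σ} (hij : i ≠ j)
    {φ : MvPowerSeries σ A} (h : (X i : MvPowerSeries σ A) ∣ X j * φ) :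
    (X i : MvPowerSeries σ A) ∣ φ := by
  rw [MvPowerSeries.X_dvd_iff] at h ⊢
  intro m hm
  have := h (Finsupp.single j 1 + m) (by simp [hm, Finsupp.single_eq_of_ne hij])
  rwa [MvPowerSeries.X, MvPowerSeries.coeff_add_monomial_mul, one_mul] at this

lemma varX_mul_self : varX k * varX k = 0 := by
  rw [varX, ← map_mul, ← pow_two]
  exact Ideal.Quotient.eq_zero_iff_mem.2 (Ideal.mem_span_singleton_self _)

lemma varX_dvd_of_mul_eq_zero (t : HypersurfaceA k) (h : varX k * t = 0) : varX k ∣ t := by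
  obtain ⟨t, rfl⟩ := Ideal.Quotient.mk_surjective t
  rw [varX, ← map_mul, Ideal.Quotient.eq_zero_iff_mem, Ideal.mem_span_singleton, pow_two] at h
  exact map_dvd _ ((mul_dvd_mul_iff_left (nonZeroDivisors.ne_zero MvPowerSeries.X_mem_nonzeroDivisors)).1 h)

/-- The modulus `x ^ 2` is itself a multiple of `x`, so divisibility by `x` lifts to power series.
-/
lemma varX_dvd_mk_iff (t : MvPowerSeries (Fin 2) k) :
    varX k ∣ Ideal.Quotient.mk _ t ↔ MvPowerSeries.X 0 ∣ t := by
  refine ⟨fun ⟨s, hs⟩ => ?_, fun h => map_dvd _ h⟩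
  obtain ⟨s, rfl⟩ := Ideal.Quotient.mk_surjective s
  rw [varX, ← map_mul, Ideal.Quotient.eq, Ideal.mem_span_singleton, pow_two] at hs
  exact (dvd_sub_left (dvd_mul_right _ s)).1 ((dvd_mul_right _ _).trans hs)

lemma varX_dvd_of_dvd_varY_mul (t : HypersurfaceA k) (h : varX k ∣ varY k * t) : varX k ∣ t := by
  obtain ⟨t, rfl⟩ := Ideal.Quotient.mk_surjective t
  rw [varY, ← map_mul, varX_dvd_mk_iff] at h
  exact (varX_dvd_mk_iff k t).2 (MvPowerSeries.X_dvd_of_X_dvd_X_mul (by decide) h)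

lemma varX_mul_add_varY_mul_ne_one (s t : HypersurfaceA k) : varX k * s + varY k * t ≠ 1 := by
  obtain ⟨s, rfl⟩ := Ideal.Quotient.mk_surjective s
  obtain ⟨t, rfl⟩ := Ideal.Quotient.mk_surjective t
  intro h
  rw [varX, varY, ← map_mul, ← map_mul, ← map_add, ← map_one (Ideal.Quotient.mk _),
    Ideal.Quotient.eq, Ideal.mem_span_singleton] at h
  obtain ⟨q, hq⟩ := h
  simpa using congrArg MvPowerSeries.constantCoeff hq

lemma annihilatedBy_idealXYObj_iff (n c : ℕ) :
    annihilatedBy (SingularityCategory (HypersurfaceA k)) (varY k ^ c) (idealXYObj k n) ↔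
      n ≤ c := by
  refine ⟨le_of_annihilatedBy_span_pair (varX_mul_self k) (varX_dvd_of_mul_eq_zero k)
    (varX_dvd_of_dvd_varY_mul k) (varX_mul_add_varY_mul_ne_one k), fun h => ?_⟩
  exact annihilatedBy_ideal_of_mem (Ideal.pow_mem_of_pow_mem (I := idealXY k n)
    (Ideal.subset_span (by simp)) h)

lemma not_isZero_idealXYObj {n : ℕ} (hn : 0 < n) : ¬ IsZero (idealXYObj k n) := fun h =>
  -- A zero object would be annihilated by `y ^ 0 = 1`.
  hn.not_ge ((annihilatedBy_idealXYObj_iff k n 0).1 (h.eq_of_src _ _))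

lemma not_genIter_idealXYObj {a b m : ℕ} (h : b * m < a) :
    ¬ genIter (ObjectProperty.singleton (idealXYObj k b)) m (idealXYObj k a) := fun hm => by
  have hP : ObjectProperty.singleton (idealXYObj k b) ≤
      annihilatedBy (SingularityCategory (HypersurfaceA k)) (varY k ^ b) := by
    rw [ObjectProperty.singleton_le_iff]
    exact (annihilatedBy_idealXYObj_iff k b b).2 le_rfl
  have := genIter_le_annihilatedBy hP m _ hm
  rw [← pow_mul, annihilatedBy_idealXYObj_iff] at this
  exact h.not_ge this

end Hypersurface

theorem mainTheorem5 (k : Type u) [Field k] (a b : ℕ) (hb : 0 < b) (hab : 2 * b < a) :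
    ¬ IsZero (idealXYObj k a) ∧ ¬ IsZero (idealXYObj k b) ∧
    ¬ genIter (ObjectProperty.singleton (idealXYObj k b)) 2 (idealXYObj k a) ∧
    2 ≤ level (idealXYObj k b) (idealXYObj k a) := by
  refine ⟨not_isZero_idealXYObj k (by lia), not_isZero_idealXYObj k hb,
    not_genIter_idealXYObj k (by lia), le_sInf ?_⟩
  rintro _ ⟨n, rfl, hn⟩
  by_contra! hlt
  have hn2 : n < 2 := by exact_mod_cast hlt
  -- Level `n` means membership in `⟨M⟩_{n+1}`, and `n < 2` gives `b * (n + 1) ≤ 2 * b < a`.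
  refine not_genIter_idealXYObj k (lt_of_le_of_lt ?_ hab) hn
  rw [mul_comm]
  exact Nat.mul_le_mul_right b hn2
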